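/- **Soundness of the interpretation of a higher-order language with input/output into guarded interaction trees.** *Guarded interaction trees.* Fix a set $\mathsf{Error}$ with an element $\mathsf{RunTime}$. Work in guarded type theory, interpreted in time-indexed sets (presheaves over $\omega$), with later modality $\blacktriangleright$ and $\mathsf{Next}:A\to\blacktriangleright A$. Let $\mathsf{IT}$ be the solution of $$\mathsf{IT}\simeq \mathbb N+\blacktriangleright(\mathsf{IT}\to\mathsf{IT})+\mathsf{Error}+\blacktriangleright\mathsf{IT}+\textstyle\sum_{i\in\{\mathtt{input},\mathtt{output}\}}\mathrm{Ins}_i\times(\mathrm{Outs}_i\to\blacktriangleright\mathsf{IT}),$$ with constructors $\mathsf{Nat},\mathsf{Fun},\mathsf{Err},\mathsf{Tau},\mathsf{Vis}_i$, where $\mathrm{Ins}_{\mathtt{input}}=1$, $\mathrm{Outs}_{\mathtt{input}}=\mathbb N$, $\mathrm{Ins}_{\mathtt{output}}=\mathbb N$, $\mathrm{Outs}_{\mathtt{output}}=1$. Put $\mathsf{Tick}=\mathsf{Tau}\circ\mathsf{Next}$. The values are the trees $\mathsf{Nat}(n)$ and $\mathsf{Fun}(g)$. A homomorphism is a map $f:\mathsf{IT}\to\mathsf{IT}$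 with $f(\mathsf{Err}(e))=\mathsf{Err}(e)$, $f(\mathsf{Tau}(t))=\mathsf{Tau}((\blacktriangleright f)(t))$ and $f(\mathsf{Vis}_i(x,k))=\mathsf{Vis}_i(x,\blacktriangleright f\circ k)$; it is determined by its action on values. Let $\mathrm{getval}(-,f)$, $\mathrm{getnat}(-,f)$, $\mathrm{getfun}(-,f)$ be the homomorphisms with $\mathrm{getval}(v,f)=f(v)$ for values $v$; $\mathrm{getnat}(\mathsf{Nat}(n),f)=f(n)$, $\mathrm{getnat}(\mathsf{Fun}(g),f)=\mathsf{Err}(\mathsf{RunTime})$; $\mathrm{getfun}(\mathsf{Fun}(g),f)=f(g)$, $\mathrm{getfun}(\mathsf{Nat}(n),f)=\mathsf{Err}(\mathsf{RunTime})$. *Reductions.* States are pairs $\sigma=(\vec n,\vec m)$ of lists of natural numbers (input and output tape). Put $r_{\mathtt{input}}((),(n\vec n,\vec m))=\mathsf{Some}(n,(\vec n,\vec m))$, $r_{\mathtt{input}}((),(\epsilon,\vec m))=\mathsf{None}$, $r_{\mathtt{output}}(x,(\vec n,\vec m))=\mathsf{Some}((),(\vec n,x\vec m))$. Let $\mathrm{reify}(\mathsf{Vis}_i(x,k),\sigma)=(\mathsf{Tau}(k\,y),\sigma')$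 if $r_i(x,\sigma)=\mathsf{Some}(y,\sigma')$, and $(\mathsf{Err}(\mathsf{RunTime}),\sigma)$ if $r_i(x,\sigma)=\mathsf{None}$. Let $(\alpha,\sigma)\rightsquigarrow(\beta,\sigma')$ mean $$(\alpha=\mathsf{Tick}(\beta)\wedge\sigma=\sigma')\ \vee\ \exists i,x,k.\ \alpha=\mathsf{Vis}_i(x,k)\wedge\mathrm{reify}(\alpha,\sigma)=(\mathsf{Tick}(\beta),\sigma'),$$ let $\rightsquigarrow^k$ be its $k$-fold iterate, and $\rightsquigarrow^*$ its reflexive-transitive closure. This formula can be read in the internal logic of time-indexed sets, where it holds or fails at each time $n$, or at the meta level, for global elements. *The language.* Up to renaming of bound variables (with $f\neq x$ in $\mathsf{rec}\,f\,x=e$), $$v::=n\mid\mathsf{rec}\,f\,x=e,\qquad e::=x\mid v\mid\mathsf{if}\ e\ \mathsf{then}\ e_1\ \mathsf{else}\ e_2\mid e_1\,e_2\mid e_1\oplus e_2\mid\mathsf{Input}\mid\mathsf{Output}(e),$$ where $\oplus$ ranges over addition, truncated subtraction, multiplication and any other total operations $\mathbb N\times\mathbb N\to\mathbb N$. Evaluation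 contexts are $$K::=\square\mid\mathsf{Output}(K)\mid\mathsf{if}\ K\ \mathsf{then}\ e_1\ \mathsf{else}\ e_2\mid e\,K\mid K\,v\mid e\oplus K\mid K\oplus v.$$ The small-step relation is generated by - $((\mathsf{rec}\,f\,x=e)\,v,\sigma)\to(e[v/x][(\mathsf{rec}\,f\,x=e)/f],\sigma)$; - $(n_1\oplus n_2,\sigma)\to(n,\sigma)$, where the numeral $n$ is the value of $n_1\oplus n_2$; - $(\mathsf{if}\ 0\ \mathsf{then}\ e_1\ \mathsf{else}\ e_2,\sigma)\to(e_2,\sigma)$, and $(\mathsf{if}\ n\ \mathsf{then}\ e_1\ \mathsf{else}\ e_2,\sigma)\to(e_1,\sigma)$ for $n>0$; - $(\mathsf{Input},(n\vec n,\vec m))\to(n,(\vec n,\vec m))$ and $(\mathsf{Output}(m),(\vec n,\vec m))\to(0,(\vec n,m\vec m))$; - $(K[e_1],\sigma_1)\to(K[e_2],\sigma_2)$ whenever $(e_1,\sigma_1)\to(e_2,\sigma_2)$. *Interpretation.* For $\rho$ mapping the free variables of $e$ to trees, $[\![e]\!]_\rho\in\mathsf{IT}$ is defined by - $[\![x]\!]_\rho=\rho(x)$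 and $[\![n]\!]_\rho=\mathsf{Nat}(n)$; - $[\![\mathsf{if}\ e\ \mathsf{then}\ e_1\ \mathsf{else}\ e_2]\!]_\rho=\mathrm{getnat}([\![e]\!]_\rho,\,n\mapsto[\![e_1]\!]_\rho\text{ if }n>0,\ [\![e_2]\!]_\rho\text{ if }n=0)$; - $[\![e_1\,e_2]\!]_\rho=\mathrm{getval}([\![e_2]\!]_\rho,\,w\mapsto\mathrm{getfun}([\![e_1]\!]_\rho,\,g\mapsto\mathsf{Tau}(\blacktriangleright(h\mapsto h(w))(g))))$; - $[\![e_1\oplus e_2]\!]_\rho=\mathrm{getval}([\![e_2]\!]_\rho,\,w\mapsto\mathrm{getval}([\![e_1]\!]_\rho,\,u\mapsto u\mathbin{\hat\oplus}w))$, where $\mathsf{Nat}(a)\mathbin{\hat\oplus}\mathsf{Nat}(b)=\mathsf{Nat}(a\oplus b)$ and $u\mathbin{\hat\oplus}w=\mathsf{Err}(\mathsf{RunTime})$ for other values; - $[\![\mathsf{Input}]\!]_\rho=\mathsf{Vis}_{\mathtt{input}}((),\mathsf{Next}\circ\mathsf{Nat})$; - $[\![\mathsf{Output}(e)]\!]_\rho=\mathrm{getnat}([\![e]\!]_\rho,\,m\mapsto\mathsf{Vis}_{\mathtt{output}}(m,\_\mapsto\mathsf{Next}(\mathsf{Nat}(0))))$;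 - $[\![\mathsf{rec}\,f\,x=e]\!]_\rho=\mathrm{fix}\big(t\mapsto\mathsf{Fun}(\blacktriangleright(\alpha\mapsto(v\mapsto[\![e]\!]_{\rho[x\mapsto v][f\mapsto\alpha]}))(t))\big)$, with $\mathrm{fix}$ the guarded fixed point. **Theorem (Soundness).** If $(e_1,\sigma_1)\to(e_2,\sigma_2)$, then $([\![e_1]\!]_\rho,\sigma_1)\rightsquigarrow^{*}([\![e_2]\!]_\rho,\sigma_2)$ for every $\rho$ that maps the free variables of $e_1$ and $e_2$ to (global) trees; in particular $([\![e_1]\!],\sigma_1)\rightsquigarrow^{*}([\![e_2]\!],\sigma_2)$ for closed $e_1,e_2$. More precisely, there is a natural number $k$ such that $([\![e_1]\!]_\rho,\sigma_1)\rightsquigarrow^{k}([\![e_2]\!]_\rho,\sigma_2)$ holds both at the meta level and in the internal logic, at every time $n$. -/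

import Mathlib

/-! ### Time-indexed sets

The guarded type theory is interpreted in time-indexed sets (presheaves over `ω`).  Stage `n` holds
what is observable with `n` steps left: stage `n + 1` is time step `n`, and for the types of trees
and functions used below the additional stage `0` has one element, so that it carries no
information. -/

universe u

namespace GITree

/-- A time-indexed set: sets `X n` with restriction maps. -/
structure TSet where
  X : ℕ → Type u
  res : ∀ n, X (n + 1) → X n

namespace TSet

/-- Maps of time-indexed sets: families of functions that commute with restriction. -/
@[ext]
structure Hom (A B : TSet.{u}) where
  app : ∀ n, A.X n → B.X n
  nat : ∀ n a, B.res n (app (n + 1) a) = app n (A.res n a)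

/-- (Global) elements of a time-indexed set. -/
@[ext]
structure El (A : TSet.{u}) where
  val : ∀ n, A.X n
  res_val : ∀ n, A.res n (val (n + 1)) = val n

variable {A B C : TSet.{u}}

/-- Action of a map on global elements. -/
def Hom.el (f : Hom A B) (a : El A) : El B :=
  ⟨fun n => f.app n (a.val n), fun n => by rw [f.nat, a.res_val]⟩

protected def Hom.id (A : TSet.{u}) : Hom A A := ⟨fun _ a => a, fun _ _ => rfl⟩

def Hom.comp (g : Hom B C) (f : Hom A B) : Hom A C :=
  ⟨fun n a => g.app n (f.app n a), fun n a => by rw [g.nat, f.nat]⟩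

/-- The constant map. -/
def Hom.const (b : El B) : Hom A B := ⟨fun n _ => b.val n, fun n _ => b.res_val n⟩

abbrev prod (A B : TSet.{u}) : TSet.{u} :=
  ⟨fun n => A.X n × B.X n, fun n p => (A.res n p.1, B.res n p.2)⟩

def Hom.fst : Hom (prod A B) A := ⟨fun _ p => p.1, fun _ _ => rfl⟩

def Hom.snd : Hom (prod A B) B := ⟨fun _ p => p.2, fun _ _ => rfl⟩

def Hom.pair (f : Hom C A) (g : Hom C B) : Hom C (prod A B) :=
  ⟨fun n c => (f.app n c, g.app n c), fun n c => Prod.ext (f.nat n c) (g.nat n c)⟩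

def Hom.swap : Hom (prod A B) (prod B A) := Hom.pair Hom.snd Hom.fst

/-- Functions from a discrete type `I` to `A`. -/
abbrev pow (I : Type) (A : TSet.{u}) : TSet.{u} :=
  ⟨fun n => I → A.X n, fun n v i => A.res n (v i)⟩

/-- A family of global elements is a global element of the power. -/
def El.tuple {I : Type} (a : I → El A) : El (pow I A) :=
  ⟨fun n i => (a i).val n, fun n => funext fun i => (a i).res_val n⟩

/-- The later type `▷ A`. -/
abbrev later (A : TSet.{u}) : TSet.{u} where
  X
    | 0 => PUnit
    | n + 1 => A.X n
  res
    | 0, _ => PUnit.unit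
    | n + 1, a => A.res n a

/-- `Next : A → ▷ A`. -/
def next : Hom A (later A) where
  app
    | 0, _ => PUnit.unit
    | n + 1, a => A.res n a
  nat
    | 0, _ => rfl
    | _ + 1, _ => rfl

/-- The guarded fixed point `γ ↦ fix (t ↦ g (γ, t))`, stage by stage. -/
def fixApp (g : Hom (prod C (later A)) A) : ∀ n, C.X n → A.X n
  | 0, c => g.app 0 (c, PUnit.unit)
  | n + 1, c => g.app (n + 1) (c, fixApp g n (C.res n c))

theorem fixApp_nat (g : Hom (prod C (later A)) A) :
    ∀ n c, A.res n (fixApp g (n + 1) c) = fixApp g n (C.res n c)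
  | 0, c => g.nat 0 (c, _)
  | n + 1, c => by
    have h := g.nat (n + 1) (c, fixApp g (n + 1) (C.res (n + 1) c))
    refine h.trans ?_
    show g.app (n + 1) (C.res (n + 1) c, A.res n (fixApp g (n + 1) (C.res (n + 1) c))) = _
    rw [fixApp_nat g n]
    rfl

/-- The guarded fixed point operator, in a context `C`. -/
def fix (g : Hom (prod C (later A)) A) : Hom C A := ⟨fixApp g, fixApp_nat g⟩

end TSet

open TSet

/-! ### Guarded interaction trees -/

/-- Signatures of effects whose arities are constant functors (discrete sets); the input/output
signature is of this form. -/
structure Sig where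
  Op : Type
  Ins : Op → Type
  Outs : Op → Type

/-- The right-hand side of the guarded equation for trees,
`ℕ + H + Error + T + Σ i, Ins i × (Outs i → T)`;
it is used with `H = ▷ (IT → IT)` and `T = ▷ IT`. -/
inductive ITF (E : Sig) (Er H T : Type u) : Type u
  | nat (k : ℕ)
  | fn (h : H)
  | err (e : Er)
  | tau (t : T)
  | vis (i : E.Op) (x : E.Ins i) (k : E.Outs i → T)

def ITF.map {E : Sig} {Er H T H' T' : Type u} (p : H → H') (q : T → T') :
    ITF E Er H T → ITF E Er H' T'
  | .nat k => .nat k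
  | .fn h => .fn (p h)
  | .err e => .err e
  | .tau t => .tau (q t)
  | .vis i x k => .vis i x (fun y => q (k y))

/-- One stage of the construction of the trees: the trees `T` at stage `n`, the functions `H` from
trees to trees at stage `n` with the component `ap h : T → T` at that stage, and the restriction
`r` from the trees of stage `n + 1`. -/
structure Stage (E : Sig) (Er : Type u) where
  T : Type u
  H : Type u
  ap : H → T → T
  r : ITF E Er H T → T

/-- The stages.  Trees at stage `n + 1` are built from functions and trees at stage `n`.
A function at stage `n + 1` is a function at stage `n` with a further component on the trees of
stage `n + 1` that agrees with it after restriction; so a function at stage `n` is a family of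
functions on the trees of all stages `j ≤ n` that commutes with restriction, which is stage `n` of
the function space of time-indexed sets. -/
def stage (E : Sig) (Er : Type u) : ℕ → Stage E Er
  | 0 => ⟨PUnit, PUnit, fun _ t => t, fun _ => PUnit.unit⟩
  | n + 1 =>
    let S := stage E Er n
    { T := ITF E Er S.H S.T
      H := { p : S.H × (ITF E Er S.H S.T → ITF E Er S.H S.T) //
              ∀ x, S.r (p.2 x) = S.ap p.1 (S.r x) }
      ap := fun h => h.1.2
      r := ITF.map (fun h => h.1.1) S.r }

/-- Guarded interaction trees over the signature `E` with errors `Er`. By construction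
`IT.X (n + 1)` is `ITF E Er ((IT → IT).X n) (IT.X n)`, i.e. `IT` solves
`IT ≃ ℕ + ▷ (IT → IT) + Error + ▷ IT + Σ i, Ins i × (Outs i → ▷ IT)`. -/
def IT (E : Sig) (Er : Type u) : TSet.{u} :=
  ⟨fun n => (stage E Er n).T, fun n => (stage E Er n).r⟩

/-- The function space `IT → IT`. -/
def Fn (E : Sig) (Er : Type u) : TSet.{u} :=
  ⟨fun n => (stage E Er n).H, fun _ h => h.1.1⟩

/-- The guarded equation for `IT` at time `n`. -/
theorem IT_X_succ (E : Sig) (Er : Type u) (n : ℕ) :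
    (IT E Er).X (n + 1) = ITF E Er ((later (Fn E Er)).X (n + 1)) ((later (IT E Er)).X (n + 1)) :=
  rfl

section Constructors

variable {E : Sig} {Er : Type u}

/-- Application `(IT → IT) × IT → IT`. -/
def eval : Hom (prod (Fn E Er) (IT E Er)) (IT E Er) :=
  ⟨fun n p => (stage E Er n).ap p.1 p.2, fun _ p => p.1.2 p.2⟩

/-- The function `v ↦ f (c, v)` at stage `n`. -/
def lamApp {C : TSet.{u}} (f : Hom (prod C (IT E Er)) (IT E Er)) :
    ∀ n (c : C.X n), { h : (Fn E Er).X n // ∀ a, eval.app n (h, a) = f.app n (c, a) }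
  | 0, _ => ⟨PUnit.unit, fun _ => rfl⟩
  | n + 1, c =>
    ⟨⟨((lamApp f n (C.res n c)).1, fun a => f.app (n + 1) (c, a)),
      fun a => (f.nat n (c, a)).trans ((lamApp f n (C.res n c)).2 _).symm⟩, fun _ => rfl⟩

/-- Abstraction: `c ↦ (v ↦ f (c, v))`. -/
def lam {C : TSet.{u}} (f : Hom (prod C (IT E Er)) (IT E Er)) : Hom C (Fn E Er) :=
  ⟨fun n c => (lamApp f n c).1, fun _ _ => rfl⟩

/-- The tree `Nat k`. -/
def NatT (k : ℕ) : El (IT E Er) where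
  val
    | 0 => PUnit.unit
    | _ + 1 => .nat k
  res_val
    | 0 => rfl
    | _ + 1 => rfl

/-- The tree `Err e`. -/
def Err (e : Er) : El (IT E Er) where
  val
    | 0 => PUnit.unit
    | _ + 1 => .err e
  res_val
    | 0 => rfl
    | _ + 1 => rfl

/-- `Fun : ▷ (IT → IT) → IT`. -/
def Fun : Hom (later (Fn E Er)) (IT E Er) where
  app
    | 0, _ => PUnit.unit
    | _ + 1, h => .fn h
  nat
    | 0, _ => rfl
    | _ + 1, _ => rfl

/-- `Tau : ▷ IT → IT`. -/
def Tau : Hom (later (IT E Er)) (IT E Er) where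
  app
    | 0, _ => PUnit.unit
    | _ + 1, t => .tau t
  nat
    | 0, _ => rfl
    | _ + 1, _ => rfl

/-- `Vis i (x, -) : (Outs i → ▷ IT) → IT`. -/
def Vis (i : E.Op) (x : E.Ins i) : Hom (pow (E.Outs i) (later (IT E Er))) (IT E Er) where
  app
    | 0, _ => PUnit.unit
    | _ + 1, k => .vis i x k
  nat
    | 0, _ => rfl
    | _ + 1, _ => rfl

/-- `Tick = Tau ∘ Next`. -/
def Tick : Hom (IT E Er) (IT E Er) := Tau.comp next

end Constructors

/-! ### Operations on trees

An operation with a function argument is given in a context `C`: the argument is a family of maps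
depending on `c : C`, and the operation is then a map of the tree and of `c`. -/

section Operations

variable {E : Sig} {Er : Type u} {C : TSet.{u}}

/-- The homomorphism (it preserves errors, ticks and effects) with a given action on the values
`Nat k` and `Fun g`, stage by stage. -/
def homApp (fN : ℕ → Hom C (IT E Er)) (fF : Hom (prod C (later (Fn E Er))) (IT E Er)) :
    ∀ n, (IT E Er).X n → C.X n → (IT E Er).X n
  | 0, _, _ => PUnit.unit
  | n + 1, .nat k, c => (fN k).app (n + 1) c
  | n + 1, .fn g, c => fF.app (n + 1) (c, g)
  | _ + 1, .err e, _ => .err e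
  | n + 1, .tau t, c => .tau (homApp fN fF n t (C.res n c))
  | n + 1, .vis i x k, c => .vis i x fun y => homApp fN fF n (k y) (C.res n c)

theorem homApp_nat (fN : ℕ → Hom C (IT E Er)) (fF : Hom (prod C (later (Fn E Er))) (IT E Er)) :
    ∀ n t c, (IT E Er).res n (homApp fN fF (n + 1) t c)
      = homApp fN fF n ((IT E Er).res n t) (C.res n c)
  | 0, _, _ => rfl
  | n + 1, .nat k, c => (fN k).nat (n + 1) c
  | n + 1, .fn g, c => fF.nat (n + 1) (c, g)
  | _ + 1, .err _, _ => rfl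
  | n + 1, .tau t, c => congrArg ITF.tau (homApp_nat fN fF n t (C.res (n + 1) c))
  | n + 1, .vis i x k, c =>
    congrArg (ITF.vis i x) (funext fun y => homApp_nat fN fF n (k y) (C.res (n + 1) c))

/-- The homomorphism with a given action on the values `Nat k` and `Fun g`. -/
def hom (fN : ℕ → Hom C (IT E Er)) (fF : Hom (prod C (later (Fn E Er))) (IT E Er)) :
    Hom (prod (IT E Er) C) (IT E Er) :=
  ⟨fun n p => homApp fN fF n p.1 p.2, fun n p => homApp_nat fN fF n p.1 p.2⟩

/-- `get_val (α, v ↦ f (c, v))`. -/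
def getVal (f : Hom (prod C (IT E Er)) (IT E Er)) : Hom (prod (IT E Er) C) (IT E Er) :=
  hom (fun k => f.comp (Hom.pair (Hom.id C) (Hom.const (NatT k))))
    (f.comp (Hom.pair Hom.fst (Fun.comp Hom.snd)))

/-- `get_nat (α, k ↦ f k c)`; `rt` is the run-time error. -/
def getNat (rt : Er) (f : ℕ → Hom C (IT E Er)) : Hom (prod (IT E Er) C) (IT E Er) :=
  hom f (Hom.const (Err rt))

/-- `get_fun (α, g ↦ f (c, g))`. -/
def getFun (rt : Er) (f : Hom (prod C (later (Fn E Er))) (IT E Er)) :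
    Hom (prod (IT E Er) C) (IT E Er) :=
  hom (fun _ => Hom.const (Err rt)) f

/-- `(β, g) ↦ ▷ (h ↦ h β) (g) : ▷ IT`. -/
def laterApply : Hom (prod (IT E Er) (later (Fn E Er))) (later (IT E Er)) where
  app
    | 0, _ => PUnit.unit
    | n + 1, p => eval.app n (p.2, (IT E Er).res n p.1)
  nat
    | 0, _ => rfl
    | n + 1, p => eval.nat n (p.2, (IT E Er).res (n + 1) p.1)

/-- Call-by-name application `(α, β) ↦ get_fun (α, g ↦ Tau (▷ (h ↦ h β) g))`. -/
def appName (rt : Er) : Hom (prod (IT E Er) (IT E Er)) (IT E Er) :=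
  getFun rt (Tau.comp laterApply)

/-- Call-by-value application `(α, β) ↦ get_val (β, v ↦ appName (α, v))`. -/
def appVal (rt : Er) : Hom (prod (IT E Er) (IT E Er)) (IT E Er) :=
  (getVal (appName rt)).comp Hom.swap

/-- Branching `(α, (α₁, α₂)) ↦ IF (α, α₁, α₂)`: `α₁` for nonzero, `α₂` for zero. -/
def ifOp (rt : Er) : Hom (prod (IT E Er) (prod (IT E Er) (IT E Er))) (IT E Er) :=
  getNat rt fun k => if k = 0 then Hom.snd else Hom.fst

/-- `(w, v) ↦ Nat (f a b)` for `v = Nat a` and `w = Nat b`, and an error for other values. -/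
def natOpVal (rt : Er) (f : ℕ → ℕ → ℕ) : Hom (prod (IT E Er) (IT E Er)) (IT E Er) :=
  (getNat rt fun a =>
    (getNat rt fun b => Hom.const (NatT (f a b))).comp (Hom.pair (Hom.id _) (Hom.id _))).comp
      Hom.swap

/-- `(α, β) ↦ NATOP_f (α, β) = get_val (β, w ↦ get_val (α, v ↦ natOpVal f (w, v)))`. -/
def natOp (rt : Er) (f : ℕ → ℕ → ℕ) : Hom (prod (IT E Er) (IT E Er)) (IT E Er) :=
  (getVal (getVal (natOpVal rt f))).comp Hom.swap

end Operations

/-! ### Reification and reductions -/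

/-- A reifier for the effects `E` with a discrete type of states. -/
structure Reifier (E : Sig) where
  State : Type
  r : ∀ i, E.Ins i → State → Option (E.Outs i × State)

section Reductions

variable {E : Sig} {Er : Type u} (R : Reifier E) (rt : Er)

/-- The tree component of `reify (α, σ)` on a tree of a nontrivial stage. -/
def reifyTreeApp {H T : Type u} (σ : R.State) : ITF E Er H T → ITF E Er H T
  | .vis i x k =>
    match R.r i x σ with
    | some (y, _) => .tau (k y)
    | none => .err rt
  | _ => .err rt

/-- The state component of `reify (α, σ)`. -/
def reifyState {H T : Type u} (σ : R.State) : ITF E Er H T → R.State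
  | .vis i x _ =>
    match R.r i x σ with
    | some (_, σ') => σ'
    | none => σ
  | _ => σ

/-- The tree component of `reify (α, σ)`, as a map of `α`. -/
def reifyTree (σ : R.State) : Hom (IT E Er) (IT E Er) where
  app
    | 0, _ => PUnit.unit
    | _ + 1, t => reifyTreeApp R rt σ t
  nat
    | 0, _ => rfl
    | n + 1, t => by
      cases t with
      | vis i x k =>
        simp only [IT, stage, reifyTreeApp, ITF.map]
        cases R.r i x σ <;> rfl
      | _ => rfl

/-- `reify` at time `n`. -/
def reifyAt (n : ℕ) (c : (IT E Er).X (n + 1) × R.State) : (IT E Er).X (n + 1) × R.State :=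
  ((reifyTree R rt c.2).app (n + 1) c.1, reifyState R c.2 c.1)

/-- `reify` on global elements. -/
def reify (c : El (IT E Er) × R.State) : El (IT E Er) × R.State :=
  ((reifyTree R rt c.2).el c.1, reifyState R c.2 (c.1.val 1))

/-- The internal reduction relation: `IStep R rt n c d` says that the proposition
`c ⇝ d` of the guarded logic holds at time `n`. -/
def IStep (n : ℕ) (c d : (IT E Er).X (n + 1) × R.State) : Prop :=
  (c.1 = Tick.app (n + 1) d.1 ∧ c.2 = d.2) ∨
    ∃ (i : E.Op) (x : E.Ins i) (k : E.Outs i → (later (IT E Er)).X (n + 1)),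
      c.1 = (Vis i x).app (n + 1) k ∧ reifyAt R rt n c = (Tick.app (n + 1) d.1, d.2)

/-- `ISteps R rt n m c d` says that `c ⇝^m d` (exactly `m` internal reductions) holds at time
`n`. -/
def ISteps (n : ℕ) : ℕ → (IT E Er).X (n + 1) × R.State → (IT E Er).X (n + 1) × R.State → Prop
  | 0, c, d => c = d
  | m + 1, c, d => ∃ b, IStep R rt n c b ∧ ISteps n m b d

/-- The same relation read at the meta level, on global elements. -/
def Step (c d : El (IT E Er) × R.State) : Prop :=
  (c.1 = Tick.el d.1 ∧ c.2 = d.2) ∨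
    ∃ (i : E.Op) (x : E.Ins i) (k : E.Outs i → El (later (IT E Er))),
      c.1 = (Vis i x).el (El.tuple k) ∧ reify R rt c = (Tick.el d.1, d.2)

/-- `m`-fold reduction at the meta level. -/
def Steps : ℕ → El (IT E Er) × R.State → El (IT E Er) × R.State → Prop
  | 0, c, d => c = d
  | m + 1, c, d => ∃ b, Step R rt c b ∧ Steps m b d

end Reductions

/-- The configuration at time `n` of a global configuration. -/
def atTime {E : Sig} {Er : Type u} {S : Type} (n : ℕ) (c : El (IT E Er) × S) :
    (IT E Er).X (n + 1) × S :=
  (c.1.val (n + 1), c.2)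

/-! ### Input and output on tapes -/

inductive IOOp
  | input
  | output

/-- The signature of input/output. -/
def ioSig : Sig where
  Op := IOOp
  Ins
    | .input => Unit
    | .output => ℕ
  Outs
    | .input => ℕ
    | .output => Unit

/-- Input and output tapes. -/
abbrev Tapes := List ℕ × List ℕ

/-- The reifier of input/output. -/
def ioReifier : Reifier ioSig where
  State := Tapes
  r
    | .input, _, (k :: ks, ms) => some (k, (ks, ms))
    | .input, _, ([], _) => none
    | .output, x, (ks, ms) => some ((), (ks, x :: ms))

/-- `INPUT = Vis input ((), Next ∘ Nat)`. -/
def INPUT {Er : Type u} : El (IT ioSig Er) :=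
  (Vis (E := ioSig) IOOp.input ()).el (El.tuple fun k : ℕ => next.el (NatT k))

/-- `OUTPUT m = Vis output (m, _ ↦ Next (Nat 0))`. -/
def OUTPUT {Er : Type u} (m : ℕ) : El (IT ioSig Er) :=
  (Vis (E := ioSig) IOOp.output m).el (El.tuple fun _ : Unit => next.el (NatT 0))

/-! ### The language

Terms are taken up to renaming of bound variables: `Expr m` are the expressions with free variables
among `m` variables, in well-scoped de Bruijn notation. -/

namespace IOLang

/-- Binary operation symbols; `other` stands for any further total operation. Subtraction of
natural numbers is truncated. -/
inductive BinOp
  | add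
  | sub
  | mul
  | other (f : ℕ → ℕ → ℕ)

def BinOp.den : BinOp → ℕ → ℕ → ℕ
  | add => (· + ·)
  | sub => (· - ·)
  | mul => (· * ·)
  | other f => f

/-- Expressions; in `recfn e`, standing for `rec f x = e`, variable `0` of `e` is `f` and variable
`1` is `x`. -/
inductive Expr : ℕ → Type
  | var {m : ℕ} (i : Fin m) : Expr m
  | lit {m : ℕ} (k : ℕ) : Expr m
  | recfn {m : ℕ} (e : Expr (m + 2)) : Expr m
  | ite {m : ℕ} (e e₁ e₂ : Expr m) : Expr m
  | app {m : ℕ} (e₁ e₂ : Expr m) : Expr m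
  | bin {m : ℕ} (op : BinOp) (e₁ e₂ : Expr m) : Expr m
  | input {m : ℕ} : Expr m
  | output {m : ℕ} (e : Expr m) : Expr m

/-- Values are numerals and recursive functions. -/
inductive IsVal {m : ℕ} : Expr m → Prop
  | lit (k : ℕ) : IsVal (.lit k)
  | recfn (e : Expr (m + 2)) : IsVal (.recfn e)

/-- Extend a renaming under a binder. -/
def liftRen {m k : ℕ} (s : Fin m → Fin k) : Fin (m + 1) → Fin (k + 1) :=
  Fin.cons 0 fun i => (s i).succ

def Expr.rename : {m k : ℕ} → (Fin m → Fin k) → Expr m → Expr k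
  | _, _, s, .var i => .var (s i)
  | _, _, _, .lit k => .lit k
  | _, _, s, .recfn e => .recfn (e.rename (liftRen (liftRen s)))
  | _, _, s, .ite e e₁ e₂ => .ite (e.rename s) (e₁.rename s) (e₂.rename s)
  | _, _, s, .app e₁ e₂ => .app (e₁.rename s) (e₂.rename s)
  | _, _, s, .bin op e₁ e₂ => .bin op (e₁.rename s) (e₂.rename s)
  | _, _, _, .input => .input
  | _, _, s, .output e => .output (e.rename s)

/-- Extend a substitution under a binder. -/
def liftSubst {m k : ℕ} (s : Fin m → Expr k) : Fin (m + 1) → Expr (k + 1) :=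
  Fin.cons (.var 0) fun i => (s i).rename Fin.succ

/-- Capture-avoiding simultaneous substitution. -/
def Expr.subst : {m k : ℕ} → (Fin m → Expr k) → Expr m → Expr k
  | _, _, s, .var i => s i
  | _, _, _, .lit k => .lit k
  | _, _, s, .recfn e => .recfn (e.subst (liftSubst (liftSubst s)))
  | _, _, s, .ite e e₁ e₂ => .ite (e.subst s) (e₁.subst s) (e₂.subst s)
  | _, _, s, .app e₁ e₂ => .app (e₁.subst s) (e₂.subst s)
  | _, _, s, .bin op e₁ e₂ => .bin op (e₁.subst s) (e₂.subst s)
  | _, _, _, .input => .input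
  | _, _, s, .output e => .output (e.subst s)

/-- `e[v/x][g/f]`. -/
def Expr.inst {m : ℕ} (e : Expr (m + 2)) (g v : Expr m) : Expr m :=
  e.subst (Fin.cons g (Fin.cons v .var))

/-- Evaluation contexts (call-by-value, right to left). -/
inductive Ectx (m : ℕ) : Type
  | hole
  | output (K : Ectx m)
  | ite (K : Ectx m) (e₁ e₂ : Expr m)
  | appR (e : Expr m) (K : Ectx m)
  | appL (K : Ectx m) (v : Expr m) (hv : IsVal v)
  | binR (op : BinOp) (e : Expr m) (K : Ectx m)
  | binL (op : BinOp) (K : Ectx m) (v : Expr m) (hv : IsVal v)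

/-- `K[e]`. -/
def Ectx.fill {m : ℕ} : Ectx m → Expr m → Expr m
  | .hole, e => e
  | .output K, e => .output (K.fill e)
  | .ite K e₁ e₂, e => .ite (K.fill e) e₁ e₂
  | .appR e' K, e => .app e' (K.fill e)
  | .appL K v _, e => .app (K.fill e) v
  | .binR op e' K, e => .bin op e' (K.fill e)
  | .binL op K v _, e => .bin op (K.fill e) v

/-- The small-step operational semantics. -/
inductive Red {m : ℕ} : Expr m × Tapes → Expr m × Tapes → Prop
  | beta (e : Expr (m + 2)) (v : Expr m) (hv : IsVal v) (σ : Tapes) :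
      Red (.app (.recfn e) v, σ) (e.inst (.recfn e) v, σ)
  | bin (op : BinOp) (a b : ℕ) (σ : Tapes) :
      Red (.bin op (.lit a) (.lit b), σ) (.lit (op.den a b), σ)
  | iteFalse (e₁ e₂ : Expr m) (σ : Tapes) : Red (.ite (.lit 0) e₁ e₂, σ) (e₂, σ)
  | iteTrue (k : ℕ) (hk : 0 < k) (e₁ e₂ : Expr m) (σ : Tapes) :
      Red (.ite (.lit k) e₁ e₂, σ) (e₁, σ)
  | input (k : ℕ) (ks ms : List ℕ) : Red (.input, (k :: ks, ms)) (.lit k, (ks, ms))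
  | output (k : ℕ) (ks ms : List ℕ) : Red (.output (.lit k), (ks, ms)) (.lit 0, (ks, k :: ms))
  | ectx (K : Ectx m) {e₁ e₂ : Expr m} {σ₁ σ₂ : Tapes} (h : Red (e₁, σ₁) (e₂, σ₂)) :
      Red (K.fill e₁, σ₁) (K.fill e₂, σ₂)

/-! ### Interpretation -/

section Interpretation

variable {Er : Type u}

/-- Environments for `m` variables. -/
abbrev Env (Er : Type u) (m : ℕ) : TSet.{u} := pow (Fin m) (IT ioSig Er)

/-- `((ρ, α), v) ↦ ρ[x ↦ v][f ↦ α]`. -/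
def extend (m : ℕ) :
    Hom (prod (prod (Env Er m) (IT ioSig Er)) (IT ioSig Er)) (Env Er (m + 2)) where
  app := fun _ p => Fin.cons p.1.2 (Fin.cons p.2 p.1.1)
  nat := fun n p => by
    funext i
    refine Fin.cases rfl (fun i => ?_) i
    exact Fin.cases rfl (fun _ => rfl) i

/-- `(ρ, t) ↦ ▷ (α ↦ (v ↦ b (ρ[x ↦ v][f ↦ α]))) (t) : ▷ (IT → IT)`. -/
def laterBody {m : ℕ} (b : Hom (Env Er (m + 2)) (IT ioSig Er)) :
    Hom (prod (Env Er m) (later (IT ioSig Er))) (later (Fn ioSig Er)) where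
  app
    | 0, _ => PUnit.unit
    | n + 1, p => (lam (b.comp (extend m))).app n ((Env Er m).res n p.1, p.2)
  nat
    | 0, _ => rfl
    | n + 1, p => (lam (b.comp (extend m))).nat n ((Env Er m).res (n + 1) p.1, p.2)

/-- The interpretation of expressions; `rt` is the run-time error. -/
def sem (rt : Er) : {m : ℕ} → Expr m → Hom (Env Er m) (IT ioSig Er)
  | _, .var i => ⟨fun _ ρ => ρ i, fun _ _ => rfl⟩
  | _, .lit k => Hom.const (NatT k)
  | _, .recfn e => fix (Fun.comp (laterBody (sem rt e)))
  | _, .ite e e₁ e₂ => (ifOp rt).comp (Hom.pair (sem rt e) (Hom.pair (sem rt e₁) (sem rt e₂)))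
  | _, .app e₁ e₂ => (appVal rt).comp (Hom.pair (sem rt e₁) (sem rt e₂))
  | _, .bin op e₁ e₂ => (natOp rt op.den).comp (Hom.pair (sem rt e₁) (sem rt e₂))
  | _, .input => Hom.const INPUT
  | _, .output e =>
    (getNat rt fun k => Hom.const (OUTPUT k)).comp (Hom.pair (sem rt e) (Hom.id _))

/-- The tree `⟦e⟧_ρ`. For closed `e` (`m = 0`) there is exactly one `ρ`. -/
def interp (rt : Er) {m : ℕ} (e : Expr m) (ρ : Fin m → El (IT ioSig Er)) : El (IT ioSig Er) :=
  (sem rt e).el (El.tuple ρ)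

end Interpretation

end IOLang

end GITree

namespace GITree

open TSet

/-! ### Homomorphisms and reductions -/

/-! Evaluation contexts are interpreted by homomorphisms of trees, and homomorphisms preserve
reductions (`Step.hom`): they commute with `Tick` and act under `Vis` only on the continuation,
while the reifier looks only at the operation, its argument and the state. So a reduction in the
hole becomes one of the same length around it (`Steps.fill`). The evaluation order matters here:
application and binary operations inspect their right operand first, so the left operand is in
homomorphic position only once the right one is a value, as the grammar of contexts demands.

It remains to treat the basic rules. Conditionals and binary operations on numerals are equalities
of trees (no step), input and output are a single `Vis` step, and a beta step is a single `Tick`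
(`interp_beta`). The last rests on the substitution lemma `sem_subst`, whose binder case compares
two guarded fixed points by Löb induction, carried out as induction on the stage. Hence the length
is always 0 or 1.

All this is done for global trees. A meta-level step consists of equations between global elements,
and their components at stage `n + 1` are an internal step at time `n`. -/

instance (E : Sig) (Er : Type u) : Subsingleton ((IT E Er).X 0) :=
  inferInstanceAs (Subsingleton PUnit)

/-- Global trees are equal as soon as they agree at all nontrivial stages. -/
theorem El.ext_succ {E : Sig} {Er : Type u} {a b : El (IT E Er)}
    (h : ∀ n, a.val (n + 1) = b.val (n + 1)) : a = b := by
  refine El.ext (funext fun n => ?_)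
  cases n with
  | zero => exact Subsingleton.elim _ _
  | succ n => exact h n

/-- The pair of two global elements. -/
def elPair {A B : TSet.{u}} (a : El A) (b : El B) : El (prod A B) :=
  ⟨fun n => (a.val n, b.val n), fun n => Prod.ext (a.res_val n) (b.res_val n)⟩

section Homomorphisms

variable {E : Sig} {Er : Type u} {C D : TSet.{u}}

/-- Precomposition of the context of a homomorphism. -/
theorem homApp_comp (h : Hom D C) (fN : ℕ → Hom C (IT E Er))
    (fF : Hom (prod C (later (Fn E Er))) (IT E Er)) :
    ∀ n t d, homApp (fun k => (fN k).comp h) (fF.comp (Hom.pair (h.comp Hom.fst) Hom.snd)) n t d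
      = homApp fN fF n t (h.app n d)
  | 0, _, _ => rfl
  | _ + 1, .nat _, _ => rfl
  | _ + 1, .fn _, _ => rfl
  | _ + 1, .err _, _ => rfl
  | n + 1, .tau t, d => by
    simp only [homApp]
    rw [homApp_comp h fN fF n t, h.nat]
  | n + 1, .vis i x k, d => by
    simp only [homApp]
    refine congrArg (ITF.vis i x) (funext fun y => ?_)
    rw [homApp_comp h fN fF n (k y), h.nat]

/-- The map `▷ f` for a homomorphism `f` in a context. -/
def laterHom (fN : ℕ → Hom C (IT E Er)) (fF : Hom (prod C (later (Fn E Er))) (IT E Er))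
    (γ : El C) : Hom (later (IT E Er)) (later (IT E Er)) where
  app
    | 0, _ => PUnit.unit
    | n + 1, t => homApp fN fF n t (γ.val n)
  nat
    | 0, _ => rfl
    | n + 1, t => (homApp_nat fN fF n t (γ.val (n + 1))).trans (by rw [γ.res_val])

/-- `Next` is restriction to the previous stage, so this is naturality of `homApp` under a `tau`. -/
theorem hom_el_tick (fN : ℕ → Hom C (IT E Er)) (fF : Hom (prod C (later (Fn E Er))) (IT E Er))
    (α : El (IT E Er)) (γ : El C) :
    (hom fN fF).el (elPair (Tick.el α) γ) = Tick.el ((hom fN fF).el (elPair α γ)) :=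
  El.ext_succ fun n =>
    congrArg ITF.tau (homApp_nat fN fF n (α.val (n + 1)) (γ.val (n + 1))).symm

theorem hom_el_vis (fN : ℕ → Hom C (IT E Er)) (fF : Hom (prod C (later (Fn E Er))) (IT E Er))
    (i : E.Op) (x : E.Ins i) (k : E.Outs i → El (later (IT E Er))) (γ : El C) :
    (hom fN fF).el (elPair ((Vis i x).el (El.tuple k)) γ)
      = (Vis i x).el (El.tuple fun y => (laterHom fN fF γ).el (k y)) := by
  refine El.ext_succ fun n => congrArg (ITF.vis i x) (funext fun y => ?_)
  -- Under the effect the context is restricted by one stage; since `γ` is global, this is again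
  -- `γ`, as `laterHom` requires.
  show homApp fN fF n ((k y).val (n + 1)) (C.res n (γ.val (n + 1))) = _
  rw [γ.res_val]
  rfl

/-! ### Reification, its stability under homomorphisms, and the passage to internal reductions -/

variable (R : Reifier E) (rt : Er)

theorem reify_vis_some {i : E.Op} {x : E.Ins i} {σ σ' : R.State} {y : E.Outs i}
    (h : R.r i x σ = some (y, σ')) (k : E.Outs i → El (later (IT E Er))) :
    reify R rt ((Vis i x).el (El.tuple k), σ) = (Tau.el (k y), σ') := by
  refine Prod.ext (El.ext_succ fun n => ?_) ?_
  · show reifyTreeApp R rt σ (ITF.vis i x fun y => (k y).val (n + 1)) = _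
    simp only [reifyTreeApp, h]
    rfl
  -- The new state is read off at stage 1, where the operation and its argument are already visible.
  · show reifyState (Er := Er) (H := (Fn E Er).X 0) R σ (ITF.vis i x fun y => (k y).val 1) = _
    simp only [reifyState, h]

theorem reify_vis_none {i : E.Op} {x : E.Ins i} {σ : R.State}
    (h : R.r i x σ = none) (k : E.Outs i → El (later (IT E Er))) :
    reify R rt ((Vis i x).el (El.tuple k), σ) = (Err rt, σ) := by
  refine Prod.ext (El.ext_succ fun n => ?_) ?_
  · show reifyTreeApp R rt σ (ITF.vis i x fun y => (k y).val (n + 1)) = _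
    simp only [reifyTreeApp, h]
    rfl
  · show reifyState (Er := Er) (H := (Fn E Er).X 0) R σ (ITF.vis i x fun y => (k y).val 1) = _
    simp only [reifyState, h]

/-- The outermost constructors already differ at stage 1. This rules out reductions in which the
reifier fails. -/
theorem err_ne_tick (e : Er) (β : El (IT E Er)) : Err e ≠ Tick.el β := fun h => by
  have h₁ : (ITF.err e : ITF E Er ((Fn E Er).X 0) ((IT E Er).X 0))
      = ITF.tau ((IT E Er).res 0 (β.val 1)) := congrFun (congrArg El.val h) 1
  cases h₁

/-- Needed beside `hom_el_tick` because a continuation returns an arbitrary element of the later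
type, not one presented as a `Next`. -/
theorem hom_el_tau (fN : ℕ → Hom C (IT E Er)) (fF : Hom (prod C (later (Fn E Er))) (IT E Er))
    (t : El (later (IT E Er))) (γ : El C) :
    (hom fN fF).el (elPair (Tau.el t) γ) = Tau.el ((laterHom fN fF γ).el t) := by
  refine El.ext_succ fun n => ?_
  show ITF.tau (homApp fN fF n (t.val (n + 1)) (C.res n (γ.val (n + 1)))) = _
  rw [γ.res_val]
  rfl

/-- Homomorphisms preserve reductions. -/
theorem Step.hom (fN : ℕ → Hom C (IT E Er)) (fF : Hom (prod C (later (Fn E Er))) (IT E Er))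
    (γ : El C) {c d : El (IT E Er) × R.State} (h : Step R rt c d) :
    Step R rt ((GITree.hom fN fF).el (elPair c.1 γ), c.2)
      ((GITree.hom fN fF).el (elPair d.1 γ), d.2) := by
  obtain ⟨α, σ⟩ := c
  obtain ⟨β, σ'⟩ := d
  rcases h with ⟨h₁, h₂⟩ | ⟨i, x, k, h₁, h₂⟩
  · refine Or.inl ⟨?_, h₂⟩
    dsimp only at h₁ ⊢
    rw [h₁, hom_el_tick]
  · dsimp only at h₁
    subst h₁
    refine Or.inr ⟨i, x, _, hom_el_vis fN fF i x k γ, ?_⟩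
    dsimp only
    rw [hom_el_vis]
    cases hr : R.r i x σ with
    | none =>
      rw [reify_vis_none R rt hr] at h₂
      exact absurd (congrArg Prod.fst h₂) (err_ne_tick _ _)
    | some p =>
      obtain ⟨y, τ⟩ := p
      rw [reify_vis_some R rt hr] at h₂ ⊢
      obtain ⟨h₃, h₄⟩ := Prod.mk.inj h₂
      -- Pulling the homomorphism out of `Tau` exposes the reified tree, known to be a tick; no
      -- injectivity of `Tau` is needed.
      rw [← hom_el_tau, h₃, hom_el_tick, h₄]

theorem Steps.hom (fN : ℕ → Hom C (IT E Er)) (fF : Hom (prod C (later (Fn E Er))) (IT E Er))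
    (γ : El C) : ∀ {m : ℕ} {c d : El (IT E Er) × R.State}, Steps R rt m c d →
    Steps R rt m ((GITree.hom fN fF).el (elPair c.1 γ), c.2)
      ((GITree.hom fN fF).el (elPair d.1 γ), d.2)
  | 0, c, d, h => by
    obtain rfl : c = d := h
    rfl
  | _ + 1, _, _, ⟨b, h₁, h₂⟩ =>
    ⟨_, Step.hom R rt fN fF γ h₁, Steps.hom fN fF γ h₂⟩

/-- Reductions of global configurations hold internally at every time. -/
theorem Step.iStep {c d : El (IT E Er) × R.State} (h : Step R rt c d) (n : ℕ) :
    IStep R rt n (atTime n c) (atTime n d) := by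
  obtain ⟨α, σ⟩ := c
  obtain ⟨β, σ'⟩ := d
  rcases h with ⟨h₁, h₂⟩ | ⟨i, x, k, h₁, h₂⟩
  · exact Or.inl ⟨congrFun (congrArg El.val h₁) (n + 1), h₂⟩
  · dsimp only at h₁
    subst h₁
    exact Or.inr ⟨i, x, fun y => (k y).val (n + 1), rfl,
      Prod.ext (congrFun (congrArg (fun p => p.1.val) h₂) (n + 1)) (congrArg (fun p => p.2) h₂)⟩

theorem Steps.iSteps : ∀ {m : ℕ} {c d : El (IT E Er) × R.State}, Steps R rt m c d →
    ∀ n, ISteps R rt n m (atTime n c) (atTime n d)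
  | 0, _, _, h, n => congrArg (atTime n) h
  | _ + 1, _, _, ⟨b, h₁, h₂⟩, n => ⟨atTime n b, Step.iStep R rt h₁ n, Steps.iSteps h₂ n⟩

end Homomorphisms

/-! ### Substitution -/

/-- Abstractions of maps that agree on related contexts agree on related contexts. -/
theorem lam_congr {E : Sig} {Er : Type u} {C D : TSet.{u}} (f : Hom (prod C (IT E Er)) (IT E Er))
    (f' : Hom (prod D (IT E Er)) (IT E Er)) :
    ∀ n (c : C.X n) (d : D.X n) (r : ∀ n, C.X n → D.X n → Prop)
      (_ : ∀ n c d, r (n + 1) c d → r n (C.res n c) (D.res n d))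
      (_ : ∀ n c d a, r n c d → f.app n (c, a) = f'.app n (d, a)),
      r n c d → (lam f).app n c = (lam f').app n d
  | 0, _, _, _, _, _, _ => rfl
  | n + 1, c, d, r, hr, hf, h =>
    -- A function at stage `n + 1` also carries its components at lower stages, so the relation must
    -- survive restriction.
    Subtype.ext (Prod.ext (lam_congr f f' n _ _ r hr hf (hr n c d h))
      (funext fun a => hf (n + 1) c d a h))

namespace IOLang

variable {Er : Type u} (rt : Er)

/-- A tuple of maps as a map of environments. -/
def envHom {m k : ℕ} (s : Fin m → Hom (Env Er k) (IT ioSig Er)) : Hom (Env Er k) (Env Er m) :=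
  ⟨fun n ρ i => (s i).app n ρ, fun n ρ => funext fun i => (s i).nat n ρ⟩

/-- Interpretation of `recfn` commutes with a change of environment that the body respects. -/
theorem sem_recfn_congr {m k : ℕ} (e : Expr (m + 2)) (e' : Expr (k + 2))
    (h : Hom (Env Er k) (Env Er m))
    (he : ∀ n ρ a v, (sem rt e').app n (Fin.cons a (Fin.cons v ρ))
      = (sem rt e).app n (Fin.cons a (Fin.cons v (h.app n ρ)))) :
    ∀ n ρ, (sem rt (.recfn e')).app n ρ = (sem rt (.recfn e)).app n (h.app n ρ)
  | 0, _ => rfl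
  | n + 1, ρ => by
    -- Löb induction: under `Fun` the body is taken at stage `n`, with the fixed point at stage `n`
    -- as recursive reference. The relation lets `h` change the environment and keeps that reference
    -- equal; the induction hypothesis proves the equality.
    refine congrArg ITF.fn (lam_congr _ _ n _ _
      (fun n c d => d = (h.app n c.1, c.2)) ?_ ?_ ?_)
    · rintro n c d rfl
      exact Prod.ext (h.nat n c.1) rfl
    · rintro n c d a rfl
      exact he n c.1 c.2 a
    · refine Prod.ext (h.nat n ρ) ?_
      refine Eq.symm ((sem_recfn_congr e e' h he n _).trans ?_)
      rw [← h.nat]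
      rfl

/-- Conditionals, applications and binary operations apply a fixed operation to the subterms' trees.
Here the environment itself is the context of the homomorphism, so its change has to be moved
through `homApp`. -/
theorem sem_output_congr {m k : ℕ} (e : Expr m) (e' : Expr k)
    (h : Hom (Env Er k) (Env Er m)) (n : ℕ) (ρ : (Env Er k).X n)
    (he : (sem rt e').app n ρ = (sem rt e).app n (h.app n ρ)) :
    (sem rt (.output e')).app n ρ = (sem rt (.output e)).app n (h.app n ρ) := by
  show homApp (fun j => Hom.const (OUTPUT j)) (Hom.const (Err rt)) n ((sem rt e').app n ρ) ρ = _
  rw [he]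
  exact homApp_comp h (fun j => Hom.const (OUTPUT j)) (Hom.const (Err rt)) n _ ρ

/-- Wanted for the weakenings that a substitution undergoes when it passes under a binder. -/
theorem sem_rename : ∀ {m k : ℕ} (e : Expr m) (s : Fin m → Fin k) (n : ℕ) (ρ : (Env Er k).X n),
    (sem rt (e.rename s)).app n ρ = (sem rt e).app n (fun i => ρ (s i))
  | _, _, .var _, _, _, _ => rfl
  | _, _, .lit _, _, _, _ => rfl
  | _, _, .input, _, _, _ => rfl
  | _, _, .recfn e, s, n, ρ => by
    refine sem_recfn_congr rt e _ (envHom fun i => sem rt (.var (s i))) (fun n ρ a v => ?_) n ρ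
    rw [sem_rename e]
    congr 1
    funext i
    refine Fin.cases rfl (fun i => ?_) i
    exact Fin.cases rfl (fun _ => rfl) i
  | _, _, .ite e e₁ e₂, s, n, ρ => by
    show (ifOp rt).app n (_, (_, _)) = (ifOp rt).app n (_, (_, _))
    rw [sem_rename e, sem_rename e₁, sem_rename e₂]
  | _, _, .app e₁ e₂, s, n, ρ => by
    show (appVal rt).app n (_, _) = (appVal rt).app n (_, _)
    rw [sem_rename e₁, sem_rename e₂]
  | _, _, .bin op e₁ e₂, s, n, ρ => by
    show (natOp rt op.den).app n (_, _) = (natOp rt op.den).app n (_, _)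
    rw [sem_rename e₁, sem_rename e₂]
  | _, _, .output e, s, n, ρ =>
    sem_output_congr rt e _ (envHom fun i => sem rt (.var (s i))) n ρ (sem_rename e s n ρ)

/-- The substitution lemma. -/
theorem sem_subst : ∀ {m k : ℕ} (e : Expr m) (s : Fin m → Expr k) (n : ℕ) (ρ : (Env Er k).X n),
    (sem rt (e.subst s)).app n ρ = (sem rt e).app n (fun i => (sem rt (s i)).app n ρ)
  | _, _, .var _, _, _, _ => rfl
  | _, _, .lit _, _, _, _ => rfl
  | _, _, .input, _, _, _ => rfl
  | _, _, .recfn e, s, n, ρ => by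
    refine sem_recfn_congr rt e _ (envHom fun i => sem rt (s i)) (fun n ρ a v => ?_) n ρ
    rw [sem_subst e]
    congr 1
    funext i
    refine Fin.cases rfl (fun i => ?_) i
    refine Fin.cases rfl (fun i => ?_) i
    -- Each of the two lifts weakens `s i` once, and each weakening discards one of the new entries
    -- `a`, `v`.
    exact (sem_rename rt _ _ n _).trans (sem_rename rt _ _ n _)
  | _, _, .ite e e₁ e₂, s, n, ρ => by
    show (ifOp rt).app n (_, (_, _)) = (ifOp rt).app n (_, (_, _))
    rw [sem_subst e, sem_subst e₁, sem_subst e₂]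
  | _, _, .app e₁ e₂, s, n, ρ => by
    show (appVal rt).app n (_, _) = (appVal rt).app n (_, _)
    rw [sem_subst e₁, sem_subst e₂]
  | _, _, .bin op e₁ e₂, s, n, ρ => by
    show (natOp rt op.den).app n (_, _) = (natOp rt op.den).app n (_, _)
    rw [sem_subst e₁, sem_subst e₂]
  | _, _, .output e, s, n, ρ =>
    sem_output_congr rt e _ (envHom fun i => sem rt (s i)) n ρ (sem_subst e s n ρ)

/-! ### Soundness -/

variable {m : ℕ} (ρ : Fin m → El (IT ioSig Er))

/-- `getVal` of the interpretation of a value. -/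
theorem getVal_interp {v : Expr m} (hv : IsVal v) {C : TSet.{u}}
    (f : Hom (prod C (IT ioSig Er)) (IT ioSig Er)) (γ : El C) :
    (getVal f).el (elPair (interp rt v ρ) γ) = f.el (elPair γ (interp rt v ρ)) :=
  -- For a recursive function, one unfolding of the fixed point computes to `Fun` at every positive
  -- stage.
  El.ext_succ fun _ => by cases hv <;> rfl

/-- With a value as argument the outer `getVal` fires, leaving a homomorphism in the function
position. -/
theorem interp_app_val (e : Expr m) {v : Expr m} (hv : IsVal v) :
    interp rt (.app e v) ρ = (appName rt).el (elPair (interp rt e ρ) (interp rt v ρ)) :=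
  getVal_interp rt ρ hv (appName rt) (interp rt e ρ)

theorem interp_bin_val (op : BinOp) (e : Expr m) {v : Expr m} (hv : IsVal v) :
    interp rt (.bin op e v) ρ
      = (getVal (natOpVal rt op.den)).el (elPair (interp rt e ρ) (interp rt v ρ)) :=
  getVal_interp rt ρ hv (getVal (natOpVal rt op.den)) (interp rt e ρ)

/-- Evaluation contexts are interpreted by maps that preserve reductions. -/
theorem Steps.fill {k : ℕ} {e₁ e₂ : Expr m} {σ₁ σ₂ : Tapes}
    (h : Steps ioReifier rt k (interp rt e₁ ρ, σ₁) (interp rt e₂ ρ, σ₂)) :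
    ∀ K : Ectx m,
      Steps ioReifier rt k (interp rt (K.fill e₁) ρ, σ₁) (interp rt (K.fill e₂) ρ, σ₂)
  | .hole => h
  | .output K => Steps.hom ioReifier rt _ _ (El.tuple ρ) (Steps.fill h K)
  | .ite K f₁ f₂ =>
    Steps.hom ioReifier rt _ _ (elPair (interp rt f₁ ρ) (interp rt f₂ ρ)) (Steps.fill h K)
  | .appR f K => Steps.hom ioReifier rt _ _ (interp rt f ρ) (Steps.fill h K)
  -- The outermost homomorphism acts on the argument, not on the hole; it has to be discharged using
  -- that `v` is a value.
  | .appL K v hv => by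
    simp only [Ectx.fill, interp_app_val rt ρ _ hv]
    exact Steps.hom ioReifier rt _ _ (interp rt v ρ) (Steps.fill h K)
  | .binR _ f K => Steps.hom ioReifier rt _ _ (interp rt f ρ) (Steps.fill h K)
  | .binL op K v hv => by
    simp only [Ectx.fill, interp_bin_val rt ρ _ _ hv]
    exact Steps.hom ioReifier rt _ _ (interp rt v ρ) (Steps.fill h K)

/-- Both getters fire at once and leave a `Tau` over the applied body; unfolding the fixed point
supplies the recursive function itself as the value of `f`. The tick drops one stage, so the bodies
are compared at stage `n`. -/
theorem interp_beta (e : Expr (m + 2)) {v : Expr m} (hv : IsVal v) :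
    interp rt (.app (.recfn e) v) ρ = Tick.el (interp rt (e.inst (.recfn e) v) ρ) := by
  rw [interp_app_val rt ρ _ hv]
  refine El.ext_succ fun n => congrArg ITF.tau ?_
  -- The beta law of `lam`, followed by restriction of the target to stage `n` and the substitution
  -- lemma; only the two environments are left to compare.
  refine ((lamApp ((sem rt e).comp (extend m)) n _).2 _).trans ?_
  refine Eq.trans ?_ ((interp rt (e.inst (.recfn e) v) ρ).res_val n).symm
  refine Eq.trans ?_ (sem_subst rt e _ n _).symm
  refine congrArg ((sem rt e).app n) (funext fun i => ?_)
  have hρ : (Env Er m).res n ((El.tuple ρ).val (n + 1)) = (El.tuple ρ).val n :=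
    (El.tuple ρ).res_val n
  refine Fin.cases ?_ (fun i => ?_) i
  · show (sem rt (.recfn e)).app n ((Env Er m).res n ((El.tuple ρ).val (n + 1))) = _
    rw [hρ]
    rfl
  refine Fin.cases ?_ (fun i => ?_) i
  · exact (interp rt v ρ).res_val n
  · exact (ρ i).res_val n

/-- Soundness at the meta level. -/
theorem Red.steps {c d : Expr m × Tapes} (h : Red c d) :
    ∃ k, Steps ioReifier rt k (interp rt c.1 ρ, c.2) (interp rt d.1 ρ, d.2) := by
  induction h with
  | beta e v hv σ => exact ⟨1, (interp rt (e.inst (.recfn e) v) ρ, σ), Or.inl ⟨interp_beta rt ρ e hv, rfl⟩, rfl⟩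
  | bin op a b σ => exact ⟨0, Prod.ext (El.ext_succ fun _ => rfl) rfl⟩
  | iteFalse e₁ e₂ σ => exact ⟨0, Prod.ext (El.ext_succ fun _ => rfl) rfl⟩
  | iteTrue k hk e₁ e₂ σ =>
    refine ⟨0, Prod.ext (El.ext_succ fun n => ?_) rfl⟩
    -- A successor lets the zero test in `ifOp` compute.
    obtain ⟨k, rfl⟩ := Nat.exists_eq_succ_of_ne_zero hk.ne'
    rfl
  | input k ks ms =>
    exact ⟨1, (NatT k, (ks, ms)), Or.inr ⟨IOOp.input, (), fun j : ℕ => next.el (NatT j), rfl,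
      reify_vis_some ioReifier rt (i := IOOp.input) (x := ()) (σ := (k :: ks, ms))
        (σ' := (ks, ms)) (y := k) rfl _⟩, rfl⟩
  | output k ks ms =>
    -- `getNat` must first consume the numeral before the tree is literally a `Vis`.
    have h : interp rt (.output (.lit k)) ρ = OUTPUT k := El.ext_succ fun _ => rfl
    refine ⟨1, (NatT 0, (ks, k :: ms)),
      Or.inr ⟨IOOp.output, k, fun _ : Unit => next.el (NatT 0), h, ?_⟩, rfl⟩
    dsimp only
    rw [h]
    exact reify_vis_some ioReifier rt (i := IOOp.output) (x := k) (σ := (ks, ms))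
        (σ' := (ks, k :: ms)) (y := ()) rfl _
  | ectx K _ ih =>
    obtain ⟨k, hk⟩ := ih
    exact ⟨k, Steps.fill rt ρ hk K⟩

end IOLang

end GITree

theorem mainTheorem3 {Er : Type*} (rt : Er) {m : ℕ} (e₁ e₂ : GITree.IOLang.Expr m)
    (σ₁ σ₂ : GITree.Tapes) (hred : GITree.IOLang.Red (e₁, σ₁) (e₂, σ₂))
    (ρ : Fin m → GITree.TSet.El (GITree.IT GITree.ioSig Er)) :
    ∃ k : ℕ,
      GITree.Steps GITree.ioReifier rt k
        (GITree.IOLang.interp rt e₁ ρ, σ₁) (GITree.IOLang.interp rt e₂ ρ, σ₂) ∧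
      ∀ n : ℕ, GITree.ISteps GITree.ioReifier rt n k
        (GITree.atTime n (GITree.IOLang.interp rt e₁ ρ, σ₁))
        (GITree.atTime n (GITree.IOLang.interp rt e₂ ρ, σ₂)) := by

  obtain ⟨k, hk⟩ := GITree.IOLang.Red.steps rt ρ hred
  exact ⟨k, hk, GITree.Steps.iSteps GITree.ioReifier rt hk⟩
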